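/- Let $\rho:[0,\infty)\to[0,\infty)$ be concave and nondecreasing with $\rho(0)=0$. For $x>0$ let $\partial\rho(x)=\{w:\rho(y)\le\rho(x)+w(y-x)\ \forall y\ge 0\}$, and assume that $\lim_{x\to0^+}\sup\partial\rho(x)=\kappa<\infty$ and that $\rho$ is continuous at $0$; put $\partial\rho(0)=\{\kappa\}$ (the limit of the subgradients as $x\to0^+$), so that $\kappa=\sup\partial\rho(0)$. For a positive semidefinite $n\times n$ matrix $X$ put $\rho(X)=\sum_i\rho(\lambda_i(X))$ and let $\partial\rho(X)$ be the set of symmetric $U\preceq\kappa I$ with $\rho(Y)\le\rho(X)+\langle U,Y-X\rangle$ for all $Y\succeq0$; equivalently, the set of matrices $V\operatorname{diag}(y)V^T$ with $V$ an orthogonal matrix of eigenvectors of $X$ and $y_i\in\partial\rho(\lambda_i(X))$. There is a convex function $g:J\to\mathbb{R}$ on an interval $J\subseteq[0,\infty)$ with $$\partial g(w)=\{-x : x\ge 0,\ w\in\partial\rho(x)\}\qquad\text{for all } w\in[0,\kappa]\qquad(*)$$ where $\partial g$ is the convex subdifferential relative to $J$ ($\partial g(w)=\emptyset$ for $w\notin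 J$). Let $g$ be any such function, and let $G(W)=\sum_i g(\lambda_i(W))$ for symmetric $W$ with all eigenvalues in $J$, with convex subdifferential $\partial G$ in the space of symmetric matrices. Let $\phi$ be a differentiable real function on the symmetric $n\times n$ matrices, $A_1,\dots,A_m$ symmetric matrices, $b\in\mathbb{R}^m$, and $\mathcal A(X)=(\langle A_i,X\rangle)_{i=1}^m$. Consider the nonconvex relaxation $$\min_X\ \rho(X)+\phi(X)\quad\text{s.t. } \mathcal A(X)=b,\ X\succeq0 \qquad (1)$$ and the biconvex semidefinite program $$\min_{X,W}\ \langle X,W\rangle+G(W)+\phi(X)\quad\text{s.t. } \mathcal A(X)=b,\ X\succeq 0,\ \kappa I\succeq W\succeq0.\qquad (2)$$ For symmetric matrices, $0\preceq P\perp Q\succeq0$ means that both are positive semidefinite and $\langle P,Q\rangle=0$. A feasible $X$ is a KKT point of (1) if there are $U\in\partial\rho(X)$ and $\mu\in\mathbb{R}^m$ with $0\preceq X\perp\sum_i\mu_iA_i+U+\nabla\phi(X)\succeq0$. A feasible pair $(X,W)$ is a KKT point of (2) if there are $Z\in\partial G(W)$, a symmetric $Y$ and $\mu\in\mathbb{R}^m$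 with $$0\preceq W\perp X+Z+Y\succeq0,\qquad 0\preceq X\perp\sum_i\mu_iA_i+W+\nabla\phi(X)\succeq0,\qquad 0\preceq Y\perp\kappa I-W\succeq0.$$ Then: (a) for every KKT point $X^*$ of (1) there is a $W^*\in\partial\rho(X^*)$ such that $(X^*,W^*)$ is a KKT point of (2); (b) for every KKT point $(X^*,W^*)$ of (2), $X^*$ is a KKT point of (1) and $W^*\in\partial\rho(X^*)$. -/

import Mathlib

open Filter Topology

namespace BiconvexSDP

/-! ### Scalar subgradients -/

/-- `w` satisfies the (super)gradient inequality of the concave function `ρ : [0, ∞) → ℝ` at `x`. -/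
def IsSupergradient (ρ : ℝ → ℝ) (x w : ℝ) : Prop :=
  ∀ y : ℝ, 0 ≤ y → ρ y ≤ ρ x + w * (y - x)

/-- The set `∂ρ(x)` for a concave `ρ : [0, ∞) → ℝ` whose slope at the origin is `κ`.
For `x > 0` the bound `w ≤ κ` holds automatically. At the end point `x = 0` of the domain it
removes the numbers `w > κ`, which satisfy the gradient inequality only because `ρ` is not defined
on the left of `0`; so `∂ρ(0) = {κ}`, that is, `∂ρ(0)` consists of the limits of the subgradients
at `x → 0+`, and `κ = sup ∂ρ(0)`. -/
def superdiff (ρ : ℝ → ℝ) (κ x : ℝ) : Set ℝ :=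
  {w | IsSupergradient ρ x w ∧ w ≤ κ}

/-- The standing assumption on a regularizer `ρ : [0, ∞) → [0, ∞)` with finite slope `κ` at `0`. -/
structure IsRegularizer (ρ : ℝ → ℝ) (κ : ℝ) : Prop where
  concave : ConcaveOn ℝ (Set.Ici 0) ρ
  monotone : MonotoneOn ρ (Set.Ici 0)
  zero : ρ 0 = 0
  /-- the largest subgradient at `x` tends to the (finite) number `κ` as `x → 0+` -/
  slope : Tendsto (fun x => sSup {w | IsSupergradient ρ x w}) (𝓝[>] 0) (𝓝 κ)
  /-- `κ = sup ∂ρ(0)`; in particular `ρ` has a subgradient at `0` -/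
  sup_zero : IsLUB (superdiff ρ κ 0) κ

/-- The subdifferential at `w` of a convex function `g` with domain `J`. -/
def subdiff (J : Set ℝ) (g : ℝ → ℝ) (w : ℝ) : Set ℝ :=
  {ξ | w ∈ J ∧ ∀ t ∈ J, g w + ξ * (t - w) ≤ g t}

/-- The convex function `g` with domain `J ⊆ [0, ∞)` (and value `+∞` outside `J`) satisfies
`∂g(w) = {-x : x ≥ 0, w ∈ ∂ρ(x)}` for every `w` in the range `[0, κ]` allowed for the eigenvalues
of the variable `W`. -/
structure IsDualPenalty (ρ : ℝ → ℝ) (κ : ℝ) (J : Set ℝ) (g : ℝ → ℝ) : Prop where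
  nonneg_dom : J ⊆ Set.Ici 0
  convex : ConvexOn ℝ J g
  subdiff_eq : ∀ w ∈ Set.Icc 0 κ,
    subdiff J g w = {ξ | ∃ x : ℝ, 0 ≤ x ∧ w ∈ superdiff ρ κ x ∧ ξ = -x}

/-! ### Spectral functions of real symmetric matrices -/

variable {n m : ℕ}

/-- The inner product `⟨A, B⟩ = tr(Aᵀ B)`. -/
def frob (A B : Matrix (Fin n) (Fin n) ℝ) : ℝ := (A.transpose * B).trace

open Classical in
/-- `∑ᵢ f(λᵢ(X))` for a symmetric matrix `X`; it is only used for symmetric matrices. -/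
noncomputable def spectralSum (f : ℝ → ℝ) (X : Matrix (Fin n) (Fin n) ℝ) : ℝ :=
  if h : X.IsHermitian then ∑ i, f (h.eigenvalues i) else 0

/-- The domain of `W ↦ ∑ᵢ g(λᵢ(W))` when `g` has domain `J`: symmetric matrices with all
eigenvalues in `J`. -/
def spectralDomain (J : Set ℝ) : Set (Matrix (Fin n) (Fin n) ℝ) :=
  {W | ∃ h : W.IsHermitian, ∀ i, h.eigenvalues i ∈ J}

/-- The set `∂ρ(X)` of the concave function `X ↦ ρ(X) = ∑ᵢ ρ(λᵢ(X))` on the positive semidefinite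
matrices: the symmetric `U` that satisfy the gradient inequality on the positive semidefinite cone,
with the same convention at the boundary of the cone as in the scalar case (`U ⪯ κ I`, which is
automatic if `X` is positive definite). These are the matrices `V diag(y) Vᵀ` with `V` an orthogonal
matrix of eigenvectors of `X` and `yᵢ ∈ ∂ρ(λᵢ(X))`. -/
def matSuperdiff (ρ : ℝ → ℝ) (κ : ℝ) (X : Matrix (Fin n) (Fin n) ℝ) :
    Set (Matrix (Fin n) (Fin n) ℝ) :=
  {U | U.IsHermitian ∧
    (∀ Y : Matrix (Fin n) (Fin n) ℝ, Y.PosSemidef →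
      spectralSum ρ Y ≤ spectralSum ρ X + frob U (Y - X)) ∧
    (κ • (1 : Matrix (Fin n) (Fin n) ℝ) - U).PosSemidef}

/-- The subdifferential at `W` of the convex function `G(W) = ∑ᵢ g(λᵢ(W))`, as a function on the
space of symmetric matrices with the inner product `frob` (value `+∞` outside its domain). -/
def matSubdiff (J : Set ℝ) (g : ℝ → ℝ) (W : Matrix (Fin n) (Fin n) ℝ) :
    Set (Matrix (Fin n) (Fin n) ℝ) :=
  {Z | Z.IsHermitian ∧ W ∈ spectralDomain J ∧
    ∀ W' ∈ spectralDomain J, spectralSum g W + frob Z (W' - W) ≤ spectralSum g W'}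

/-- `D` is the gradient `∇φ(X)` of `φ`, as a function on the space of symmetric matrices with the
inner product `frob` (Fréchet differentiability). -/
def IsGradient (φ : Matrix (Fin n) (Fin n) ℝ → ℝ) (D X : Matrix (Fin n) (Fin n) ℝ) : Prop :=
  D.IsHermitian ∧ ∃ L : Matrix (Fin n) (Fin n) ℝ →L[ℝ] ℝ,
    (∀ H, L H = frob D H) ∧ HasFDerivWithinAt φ L {M | M.IsHermitian} X

/-! ### KKT points -/

/-- `0 ⪯ P ⟂ Q ⪰ 0`. -/
def Complementary (P Q : Matrix (Fin n) (Fin n) ℝ) : Prop :=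
  P.PosSemidef ∧ Q.PosSemidef ∧ frob P Q = 0

/-- `X` is a KKT point of
`min ∑ᵢ ρ(λᵢ(X)) + φ(X)` subject to `⟨Aⱼ, X⟩ = bⱼ` for all `j`, and `X ⪰ 0`. -/
def IsKKTRelaxation (ρ : ℝ → ℝ) (κ : ℝ) (φ : Matrix (Fin n) (Fin n) ℝ → ℝ)
    (A : Fin m → Matrix (Fin n) (Fin n) ℝ) (b : Fin m → ℝ)
    (X : Matrix (Fin n) (Fin n) ℝ) : Prop :=
  X.PosSemidef ∧ (∀ j, frob (A j) X = b j) ∧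
  ∃ U ∈ matSuperdiff ρ κ X, ∃ D, IsGradient φ D X ∧ ∃ μ : Fin m → ℝ,
    Complementary X (∑ j, μ j • A j + U + D)

/-- `(X, W)` is a KKT point of
`min ⟨X, W⟩ + G(W) + φ(X)` subject to `⟨Aⱼ, X⟩ = bⱼ` for all `j`, `X ⪰ 0` and `κ I ⪰ W ⪰ 0`,
where `G(W) = ∑ᵢ g(λᵢ(W))` and `g` has domain `J`. -/
def IsKKTBiconvex (J : Set ℝ) (g : ℝ → ℝ) (κ : ℝ) (φ : Matrix (Fin n) (Fin n) ℝ → ℝ)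
    (A : Fin m → Matrix (Fin n) (Fin n) ℝ) (b : Fin m → ℝ)
    (X W : Matrix (Fin n) (Fin n) ℝ) : Prop :=
  X.PosSemidef ∧ (∀ j, frob (A j) X = b j) ∧
  W.PosSemidef ∧ (κ • (1 : Matrix (Fin n) (Fin n) ℝ) - W).PosSemidef ∧
  ∃ Z ∈ matSubdiff J g W, ∃ Y, ∃ D, IsGradient φ D X ∧ ∃ μ : Fin m → ℝ,
    Complementary W (X + Z + Y) ∧
    Complementary X (∑ j, μ j • A j + W + D) ∧
    Complementary Y (κ • (1 : Matrix (Fin n) (Fin n) ℝ) - W)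

end BiconvexSDP

/-!
The argument reduces matrix subgradients to scalar ones. For any function `f` on a set `J` of reals,
a subgradient `Z` of `W ↦ ∑ᵢ f(λᵢ(W))` commutes with `W` (`mul_comm_of_mem_matSubdiff`), because
`⟨Z, ·⟩` is maximal at `W` on the orbit of `W` under rotations. Moreover, in every orthonormal
eigenbasis of `W` the diagonal of `Z` consists of subgradients of `f` at the eigenvalues
(`diag_mem_subdiff_of_mem_matSubdiff`). Conversely, scalar subgradients in a common eigenbasis make
a matrix subgradient (`conj_diagonal_mem_matSubdiff`). This applies both to `g` on `J` and to `-ρ`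
on `[0, ∞)`.

A dual penalty is the convex conjugate `g(w) = sup_{x ≥ 0} (ρ(x) - w x)`, by Fenchel duality
(`IsRegularizer.isDualPenalty_convexConj`). Now let `g` be any dual penalty.

If `U ∈ ∂ρ(X)`, then `X` and `U` have a common eigenbasis, in which the defining relation of `g`
turns `uᵢ ∈ ∂ρ(xᵢ)` into `-xᵢ ∈ ∂g(uᵢ)`. So `-X ∈ ∂G(U)`, and `W = U`, `Z = -X`, `Y = 0` satisfy the
optimality conditions of the biconvex program
(`IsDualPenalty.posSemidef_and_neg_mem_matSubdiff`).

If `(X, W)` is a KKT point of the biconvex program, then `S = X + Z + Y`, `Z` and `Y` commute with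
`W`, so `X` does too. In a common eigenbasis of `X` and `W` this gives `xᵢ = x₀ + s - y` with
`wᵢ ∈ ∂ρ(x₀)`, `s, y ≥ 0`, `s wᵢ = 0` and `y (κ - wᵢ) = 0`. The set `{x ≥ 0 : w ∈ ∂ρ(x)}` is closed
upwards for `w = 0` and downwards for `w = κ`, hence `wᵢ ∈ ∂ρ(xᵢ)` and `W ∈ ∂ρ(X)`
(`IsRegularizer.mem_superdiff_of_complementary`, `IsDualPenalty.mem_matSuperdiff`). The remaining
conditions of the two programs coincide for `U = W`.
-/

namespace BiconvexSDP

/-! ### Scalar conjugacy -/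

section Scalar

variable {ρ : ℝ → ℝ} {κ : ℝ}

lemma IsRegularizer.nonneg (h : IsRegularizer ρ κ) {x : ℝ} (hx : 0 ≤ x) : 0 ≤ ρ x := by
  have := h.monotone (Set.mem_Ici.2 le_rfl) (Set.mem_Ici.2 hx) hx
  rwa [h.zero] at this

lemma IsRegularizer.le_mul (h : IsRegularizer ρ κ) {x : ℝ} (hx : 0 ≤ x) : ρ x ≤ κ * x := by
  obtain ⟨w, hw, hwκ⟩ := h.sup_zero.nonempty
  have h1 := hw x hx
  rw [h.zero] at h1
  nlinarith [mul_le_mul_of_nonneg_right hwκ hx]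

lemma IsRegularizer.slope_nonneg (h : IsRegularizer ρ κ) : 0 ≤ κ := by
  simpa using (h.nonneg zero_le_one).trans (h.le_mul zero_le_one)

lemma IsRegularizer.supergradient_nonneg (h : IsRegularizer ρ κ) {x w : ℝ} (hx : 0 ≤ x)
    (hw : IsSupergradient ρ x w) : 0 ≤ w := by
  have h1 := hw (x + 1) (by linarith)
  have h2 := h.monotone (Set.mem_Ici.2 hx) (Set.mem_Ici.2 (by linarith : 0 ≤ x + 1))
    (by linarith)
  linarith

lemma IsRegularizer.superdiff_nonempty (h : IsRegularizer ρ κ) {x : ℝ} (hx : 0 ≤ x) :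
    (superdiff ρ κ x).Nonempty := by
  rcases hx.eq_or_lt with rfl | hx
  · refine ⟨κ, fun y hy => ?_, le_rfl⟩
    simpa [h.zero] using h.le_mul hy
  -- By concavity every slope to the right of `x` lies below every slope to the left of `x`.
  have key : ∀ z ∈ Set.Ico 0 x, ∀ s ∈ (fun y => (ρ y - ρ x) / (y - x)) '' Set.Ioi x,
      s ≤ (ρ x - ρ z) / (x - z) := by
    rintro z hz _ ⟨y, hy, rfl⟩
    exact h.concave.slope_anti_adjacent (Set.mem_Ici.2 hz.1)
      (Set.mem_Ici.2 (hx.le.trans (Set.mem_Ioi.1 hy).le)) hz.2 hy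
  have hne : ((fun y => (ρ y - ρ x) / (y - x)) '' Set.Ioi x).Nonempty :=
    Set.nonempty_Ioi.image _
  have hbdd : BddAbove ((fun y => (ρ y - ρ x) / (y - x)) '' Set.Ioi x) :=
    ⟨_, key 0 ⟨le_rfl, hx⟩⟩
  set t := sSup ((fun y => (ρ y - ρ x) / (y - x)) '' Set.Ioi x)
  have ht : IsSupergradient ρ x t := by
    intro y hy
    rcases lt_trichotomy y x with hyx | rfl | hyx
    · have := csSup_le hne (key y ⟨hy, hyx⟩)
      rw [le_div_iff₀ (by linarith)] at this
      linarith
    · simp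
    · have := le_csSup hbdd (Set.mem_image_of_mem _ hyx)
      rw [div_le_iff₀ (by linarith)] at this
      linarith
  refine ⟨t, ht, ?_⟩
  have h0 := ht 0 le_rfl
  rw [h.zero] at h0
  exact le_of_mul_le_mul_right (by linarith [h.le_mul hx.le]) hx

/-- The effective domain of the convex conjugate `w ↦ sup_{x ≥ 0} (ρ x - w x)`, restricted to
`w ≥ 0`. -/
def conjDomain (ρ : ℝ → ℝ) : Set ℝ :=
  {w | 0 ≤ w ∧ BddAbove ((fun x => ρ x - w * x) '' Set.Ici 0)}

/-- The convex conjugate `w ↦ sup_{x ≥ 0} (ρ x - w x)` of `-ρ` at `-w`; meaningful on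
`conjDomain ρ`. -/
noncomputable def convexConj (ρ : ℝ → ℝ) (w : ℝ) : ℝ :=
  sSup ((fun x => ρ x - w * x) '' Set.Ici 0)

lemma le_convexConj {w x : ℝ} (hw : w ∈ conjDomain ρ) (hx : 0 ≤ x) : ρ x - w * x ≤ convexConj ρ w :=
  le_csSup hw.2 ⟨x, hx, rfl⟩

lemma convexConj_le {w c : ℝ} (h : ∀ x, 0 ≤ x → ρ x - w * x ≤ c) : convexConj ρ w ≤ c := by
  refine csSup_le (Set.nonempty_Ici.image _) ?_
  rintro _ ⟨x, hx, rfl⟩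
  exact h x hx

lemma mem_conjDomain {w c : ℝ} (hw : 0 ≤ w) (h : ∀ x, 0 ≤ x → ρ x - w * x ≤ c) :
    w ∈ conjDomain ρ := by
  refine ⟨hw, c, ?_⟩
  rintro _ ⟨x, hx, rfl⟩
  exact h x hx

lemma convexOn_convexConj (ρ : ℝ → ℝ) : ConvexOn ℝ (conjDomain ρ) (convexConj ρ) := by
  have key : ∀ ⦃u⦄, u ∈ conjDomain ρ → ∀ ⦃v⦄, v ∈ conjDomain ρ → ∀ ⦃a b : ℝ⦄, 0 ≤ a → 0 ≤ b →
      a + b = 1 → ∀ x, 0 ≤ x →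
      ρ x - (a • u + b • v) * x ≤ a • convexConj ρ u + b • convexConj ρ v := by
    intro u hu v hv a b ha hb hab x hx
    have h1 := mul_le_mul_of_nonneg_left (le_convexConj hu hx) ha
    have h2 := mul_le_mul_of_nonneg_left (le_convexConj hv hx) hb
    have h3 : ρ x = a * ρ x + b * ρ x := by rw [← add_mul, hab, one_mul]
    simp only [smul_eq_mul]
    linarith
  refine ⟨fun u hu v hv a b ha hb hab => ?_, fun u hu v hv a b ha hb hab => ?_⟩
  · exact mem_conjDomain (add_nonneg (mul_nonneg ha hu.1) (mul_nonneg hb hv.1))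
      (key hu hv ha hb hab)
  · exact convexConj_le (key hu hv ha hb hab)

lemma IsSupergradient.sub_mul_le {x w : ℝ} (h : IsSupergradient ρ x w) {y : ℝ} (hy : 0 ≤ y) :
    ρ y - w * y ≤ ρ x - w * x := by
  linarith [h y hy]

/-- Fenchel conjugacy: the conjugate of `ρ` is a dual penalty. -/
lemma IsRegularizer.isDualPenalty_convexConj (h : IsRegularizer ρ κ) :
    IsDualPenalty ρ κ (conjDomain ρ) (convexConj ρ) := by
  refine ⟨fun w hw => hw.1, convexOn_convexConj ρ, fun w hw => Set.ext fun ξ => ⟨?_, ?_⟩⟩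
  · rintro ⟨hwJ, hξ⟩
    -- The conjugate vanishes on `[κ, ∞)`, so its subgradients on `[0, κ]` are nonpositive.
    have hκ1 : ∀ x, 0 ≤ x → ρ x - (κ + 1) * x ≤ 0 := fun x hx => by linarith [h.le_mul hx]
    have hξ0 : ξ ≤ 0 := by
      have h1 := hξ (κ + 1) (mem_conjDomain (by linarith [h.slope_nonneg]) hκ1)
      have h2 := convexConj_le hκ1
      have h3 := le_convexConj hwJ le_rfl
      rw [h.zero] at h3
      have h4 : 0 < κ + 1 - w := by linarith [hw.2]
      by_contra! h5
      nlinarith [mul_pos h5 h4]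
    refine ⟨-ξ, by linarith, ⟨fun y hy => ?_, hw.2⟩, by ring⟩
    -- A supergradient `t` at `-ξ` attains the infimum in the biconjugate of `ρ` at `-ξ`.
    obtain ⟨t, ht, -⟩ := h.superdiff_nonempty (x := -ξ) (by linarith)
    have htle : ∀ x, 0 ≤ x → ρ x - t * x ≤ ρ (-ξ) - t * (-ξ) := fun x hx => ht.sub_mul_le hx
    have h1 := hξ t (mem_conjDomain (h.supergradient_nonneg (by linarith) ht) htle)
    linarith [convexConj_le htle, le_convexConj hwJ hy]
  · rintro ⟨x, hx, ⟨hwx, -⟩, rfl⟩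
    have hle : ∀ y, 0 ≤ y → ρ y - w * y ≤ ρ x - w * x := fun y hy => hwx.sub_mul_le hy
    refine ⟨mem_conjDomain hw.1 hle, fun t ht => ?_⟩
    linarith [convexConj_le hle, le_convexConj ht hx]

/-- The inverse of `∂ρ` absorbs the multipliers of the constraints `0 ≤ w ≤ κ`: the set
`{x ≥ 0 : w ∈ ∂ρ(x)}` is closed under increasing `x` if `w = 0` and under decreasing `x ≥ 0` if
`w = κ`. -/
lemma IsRegularizer.mem_superdiff_of_complementary (h : IsRegularizer ρ κ) {w x₀ x s y : ℝ}
    (hw : w ∈ superdiff ρ κ x₀) (hx₀ : 0 ≤ x₀) (hx : 0 ≤ x) (hs : 0 ≤ s) (hy : 0 ≤ y)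
    (hsw : s * w = 0) (hyw : y * (κ - w) = 0) (hxe : x = x₀ + s - y) :
    w ∈ superdiff ρ κ x := by
  obtain ⟨hw, hwκ⟩ := hw
  refine ⟨fun z hz => ?_, hwκ⟩
  rcases mul_eq_zero.1 hyw with rfl | hwκ'
  · rcases mul_eq_zero.1 hsw with rfl | rfl
    · have : x = x₀ := by linarith
      exact this ▸ hw z hz
    · have h1 := hw z hz
      have h2 := h.monotone (Set.mem_Ici.2 hx₀) (Set.mem_Ici.2 hx) (by linarith)
      linarith
  · have hwe : w = κ := by linarith
    subst hwe
    -- It suffices that `ρ` agrees with the linear function `w * ·` at `x`.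
    suffices hρx : w * x ≤ ρ x by linarith [h.le_mul hz]
    rcases mul_eq_zero.1 hsw with rfl | rfl
    · have h0 := hw 0 le_rfl
      rw [h.zero] at h0
      rcases hx₀.eq_or_lt with rfl | hx₀
      · have : x = 0 := by linarith
        simp [this, h.zero]
      have hle : 0 ≤ 1 - x / x₀ := by rw [sub_nonneg, div_le_one hx₀]; linarith
      have hc := h.concave.2 (Set.mem_Ici.2 hx₀.le) (Set.mem_Ici.2 (le_refl (0 : ℝ)))
        (div_nonneg hx hx₀.le) hle (add_sub_cancel _ _)
      simp only [smul_eq_mul, h.zero, mul_zero, add_zero, div_mul_cancel₀ _ hx₀.ne'] at hc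
      refine le_trans ?_ hc
      calc w * x = x / x₀ * (w * x₀) := by field_simp
        _ ≤ x / x₀ * ρ x₀ := mul_le_mul_of_nonneg_left (by linarith) (by positivity)
    · simpa using h.nonneg hx

/-- The superdifferential of `ρ` is, up to sign and the bound by `κ`, the subdifferential of the
convex function `-ρ` with domain `[0, ∞)`. -/
lemma mem_subdiff_neg_iff {x w : ℝ} (hx : 0 ≤ x) :
    -w ∈ subdiff (Set.Ici 0) (fun x => -ρ x) x ↔ IsSupergradient ρ x w := by
  constructor
  · rintro ⟨-, h⟩ y hy
    linarith [h y hy]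
  · exact fun h => ⟨hx, fun t ht => by linarith [h t ht]⟩

end Scalar

/-! ### Simultaneous diagonalization -/

/-- Two commuting symmetric operators have a common orthonormal basis of eigenvectors. -/
lemma exists_common_eigenbasis {E : Type*} [NormedAddCommGroup E] [InnerProductSpace ℝ E]
    [FiniteDimensional ℝ E] {n : ℕ} (hn : Module.finrank ℝ E = n) {S T : E →ₗ[ℝ] E}
    (hS : S.IsSymmetric) (hT : T.IsSymmetric) (hST : Commute S T) :
    ∃ (b : OrthonormalBasis (Fin n) ℝ E) (s t : Fin n → ℝ),
      (∀ i, S (b i) = s i • b i) ∧ ∀ i, T (b i) = t i • b i := by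
  classical
  have hinv : ∀ μ : Module.End.Eigenvalues S, ∀ v ∈ Module.End.eigenspace S (μ : ℝ),
      T v ∈ Module.End.eigenspace S (μ : ℝ) := fun μ v hv =>
    Module.End.mapsTo_genEigenspace_of_comm hST _ _ hv
  have hTμ := fun μ => hT.restrict_invariant (hinv μ)
  let bμ := fun μ => (hTμ μ).eigenvectorBasis rfl
  let b := hS.direct_sum_isInternal.collectedOrthonormalBasis hS.orthogonalFamily_eigenspaces' bμ
  have hbS : ∀ a, S (b a) = (a.1 : ℝ) • b a := fun a =>
    Module.End.mem_eigenspace_iff.1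
      (hS.direct_sum_isInternal.collectedOrthonormalBasis_mem hS.orthogonalFamily_eigenspaces' bμ a)
  have hbT : ∀ a, T (b a) = (hTμ a.1).eigenvalues rfl a.2 • b a := by
    rintro ⟨μ, i⟩
    have h1 : b ⟨μ, i⟩ = (bμ μ i : E) := by
      simp [b, DirectSum.IsInternal.collectedOrthonormalBasis]
    have h2 := congrArg Subtype.val ((hTμ μ).apply_eigenvectorBasis rfl i)
    rw [h1]
    exact h2
  have hcard : Fintype.card (Σ μ : Module.End.Eigenvalues S,
      Fin (Module.finrank ℝ (Module.End.eigenspace S (μ : ℝ)))) = n := by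
    rw [← hn, Module.finrank_eq_card_basis b.toBasis]
  let e := Fintype.equivFinOfCardEq hcard
  refine ⟨b.reindex e, fun i => (e.symm i).1, fun i => (hTμ (e.symm i).1).eigenvalues rfl
    (e.symm i).2, fun i => ?_, fun i => ?_⟩
  · simpa using hbS (e.symm i)
  · simpa using hbT (e.symm i)

open Matrix

variable {n : ℕ}

lemma exists_common_diagonalization {A B : Matrix (Fin n) (Fin n) ℝ} (hA : A.IsHermitian)
    (hB : B.IsHermitian) (hAB : A * B = B * A) :
    ∃ (V : Matrix (Fin n) (Fin n) ℝ) (a b : Fin n → ℝ), Vᵀ * V = 1 ∧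
      A = V * diagonal a * Vᵀ ∧ B = V * diagonal b * Vᵀ := by
  have hcomm : Commute (toEuclideanLin A) (toEuclideanLin B) := by
    ext v
    simp [toLpLin_apply, hAB]
  obtain ⟨e, a, b, ha, hb⟩ := exists_common_eigenbasis (finrank_euclideanSpace_fin (𝕜 := ℝ))
    (isSymmetric_toEuclideanLin_iff.2 hA) (isSymmetric_toEuclideanLin_iff.2 hB) hcomm
  let V : Matrix (Fin n) (Fin n) ℝ := of fun i j => e j i
  have hV : Vᵀ * V = 1 := by
    ext i j
    have := orthonormal_iff_ite.1 e.orthonormal i j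
    simp only [PiLp.inner_apply, RCLike.inner_apply, conj_trivial] at this
    simp only [mul_apply, transpose_apply, one_apply, V, of_apply]
    rw [← this]
    exact Finset.sum_congr rfl fun k _ => mul_comm _ _
  have hdiag : ∀ (M : Matrix (Fin n) (Fin n) ℝ) (c : Fin n → ℝ),
      (∀ i, toEuclideanLin M (e i) = c i • e i) → M = V * diagonal c * Vᵀ := by
    intro M c hc
    have h1 : M * V = V * diagonal c := by
      ext i j
      have := congrArg (fun v => v.ofLp i) (hc j)
      simp only [toLpLin_apply, mulVec, dotProduct, PiLp.smul_apply, smul_eq_mul] at this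
      rw [mul_diagonal, mul_comm, mul_apply]
      exact this
    rw [← h1, Matrix.mul_assoc, mul_eq_one_comm.1 hV, Matrix.mul_one]
  exact ⟨V, a, b, hV, hdiag A a ha, hdiag B b hb⟩

lemma exists_diagonalization {A : Matrix (Fin n) (Fin n) ℝ} (hA : A.IsHermitian) :
    ∃ V : Matrix (Fin n) (Fin n) ℝ, Vᵀ * V = 1 ∧ A = V * diagonal hA.eigenvalues * Vᵀ := by
  refine ⟨hA.eigenvectorUnitary, ?_, ?_⟩
  · simpa [star_eq_conjTranspose] using Unitary.coe_star_mul_self hA.eigenvectorUnitary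
  · conv_lhs => rw [hA.spectral_theorem]
    simp [Unitary.conjStarAlgAut_apply, star_eq_conjTranspose]

/-! ### Spectral functions in an eigenbasis -/

lemma isHermitian_conj_diagonal (V : Matrix (Fin n) (Fin n) ℝ) (a : Fin n → ℝ) :
    (V * diagonal a * Vᵀ).IsHermitian := by
  simp [IsHermitian, conjTranspose_eq_transpose_of_trivial, Matrix.mul_assoc]

/-- The eigenvalues of `V diag(a) Vᵀ` are the entries of `a`, up to order. -/
lemma eigenvalues_conj_diagonal {V : Matrix (Fin n) (Fin n) ℝ} (hV : Vᵀ * V = 1)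
    (a : Fin n → ℝ) (h : (V * diagonal a * Vᵀ).IsHermitian) :
    Finset.univ.val.map h.eigenvalues = Finset.univ.val.map a := by
  have h1 := h.roots_charpoly_eq_eigenvalues
  have h2 : (V * diagonal a * Vᵀ).charpoly = ∏ i, (Polynomial.X - Polynomial.C (a i)) := by
    rw [Matrix.charpoly_mul_comm, ← Matrix.mul_assoc, hV, Matrix.one_mul, charpoly_diagonal]
  rw [h2, Polynomial.roots_prod _ _ (Finset.prod_ne_zero_iff.2 fun i _ =>
    Polynomial.X_sub_C_ne_zero (a i))] at h1
  simpa [Multiset.bind_singleton, Function.comp_def] using h1.symm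

lemma spectralSum_conj_diagonal (f : ℝ → ℝ) {V : Matrix (Fin n) (Fin n) ℝ} (hV : Vᵀ * V = 1)
    (a : Fin n → ℝ) : spectralSum f (V * diagonal a * Vᵀ) = ∑ i, f (a i) := by
  have h := isHermitian_conj_diagonal V a
  have h1 := congrArg (fun s => (s.map f).sum) (eigenvalues_conj_diagonal hV a h)
  rw [spectralSum, dif_pos h]
  rw [Multiset.map_map, Multiset.map_map] at h1
  exact h1

lemma conj_diagonal_mem_spectralDomain_iff {J : Set ℝ} {V : Matrix (Fin n) (Fin n) ℝ}
    (hV : Vᵀ * V = 1) {a : Fin n → ℝ} :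
    V * diagonal a * Vᵀ ∈ spectralDomain J ↔ ∀ i, a i ∈ J := by
  have key : ∀ h : (V * diagonal a * Vᵀ).IsHermitian,
      (∀ i, h.eigenvalues i ∈ J) ↔ ∀ i, a i ∈ J := by
    intro h
    have h1 := congrArg (fun s => ∀ x ∈ s, x ∈ J) (eigenvalues_conj_diagonal hV a h)
    simpa using h1
  exact ⟨fun ⟨h, hJ⟩ => (key h).1 hJ,
    fun hJ => ⟨isHermitian_conj_diagonal V a, (key _).2 hJ⟩⟩

lemma frob_eq_trace_mul {Z : Matrix (Fin n) (Fin n) ℝ} (hZ : Z.IsHermitian)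
    (M : Matrix (Fin n) (Fin n) ℝ) : frob Z M = (Z * M).trace := by
  rw [frob, ← conjTranspose_eq_transpose_of_trivial, hZ.eq]

lemma frob_conj_diagonal {Z : Matrix (Fin n) (Fin n) ℝ} (hZ : Z.IsHermitian)
    (V : Matrix (Fin n) (Fin n) ℝ) (a : Fin n → ℝ) :
    frob Z (V * diagonal a * Vᵀ) = ∑ i, (Vᵀ * Z * V) i i * a i := by
  rw [frob_eq_trace_mul hZ, ← Matrix.mul_assoc, trace_mul_comm, ← Matrix.mul_assoc,
    ← Matrix.mul_assoc, trace]
  simp [mul_diagonal]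

lemma transpose_mul_conj_mul {V : Matrix (Fin n) (Fin n) ℝ} (hV : Vᵀ * V = 1)
    (M : Matrix (Fin n) (Fin n) ℝ) : Vᵀ * (V * M * Vᵀ) * V = M := by
  calc Vᵀ * (V * M * Vᵀ) * V = (Vᵀ * V) * M * (Vᵀ * V) := by simp only [Matrix.mul_assoc]
    _ = M := by rw [hV, Matrix.one_mul, Matrix.mul_one]

lemma eq_conj_transpose_mul {V : Matrix (Fin n) (Fin n) ℝ} (hV : Vᵀ * V = 1)
    (M : Matrix (Fin n) (Fin n) ℝ) : M = V * (Vᵀ * M * V) * Vᵀ := by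
  have hV' := mul_eq_one_comm.1 hV
  calc M = (V * Vᵀ) * M * (V * Vᵀ) := by rw [hV', Matrix.one_mul, Matrix.mul_one]
    _ = V * (Vᵀ * M * V) * Vᵀ := by simp only [Matrix.mul_assoc]

/-! ### Subgradients of spectral functions -/

/-- The diagonal of a subgradient in an eigenbasis of `W` consists of scalar subgradients: vary one
eigenvalue of `W`. -/
lemma diag_mem_subdiff_of_mem_matSubdiff {J : Set ℝ} {f : ℝ → ℝ} {V Z : Matrix (Fin n) (Fin n) ℝ}
    (hV : Vᵀ * V = 1) {w : Fin n → ℝ} (hZ : Z ∈ matSubdiff J f (V * diagonal w * Vᵀ)) (i : Fin n) :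
    (Vᵀ * Z * V) i i ∈ subdiff J f (w i) := by
  obtain ⟨hZh, hW, hsub⟩ := hZ
  rw [conj_diagonal_mem_spectralDomain_iff hV] at hW
  refine ⟨hW i, fun t ht => ?_⟩
  have hmem : V * diagonal (Function.update w i t) * Vᵀ ∈ spectralDomain J := by
    rw [conj_diagonal_mem_spectralDomain_iff hV]
    intro j
    rcases eq_or_ne j i with rfl | hj
    · simpa using ht
    · simpa [hj] using hW j
  have h1 := hsub _ hmem
  have h2 : V * diagonal (Function.update w i t) * Vᵀ - V * diagonal w * Vᵀ
      = V * diagonal (fun j => Function.update w i t j - w j) * Vᵀ := by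
    rw [← Matrix.sub_mul, ← Matrix.mul_sub, diagonal_sub]
  have h3 : ∑ j, (Vᵀ * Z * V) j j * (Function.update w i t j - w j)
      = (Vᵀ * Z * V) i i * (t - w i) := by
    rw [Finset.sum_eq_single i]
    · simp
    · intro j _ hj
      simp [hj]
    · simp
  have h4 : ∑ j, f (Function.update w i t j) - ∑ j, f (w j) = f t - f (w i) := by
    rw [← Finset.sum_sub_distrib, Finset.sum_eq_single i]
    · simp
    · intro j _ hj
      simp [hj]
    · simp
  rw [h2, frob_conj_diagonal hZh, h3, spectralSum_conj_diagonal f hV,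
    spectralSum_conj_diagonal f hV] at h1
  linarith

/-- Scalar subgradients in a common eigenbasis make a matrix subgradient. In eigenbases of `W` and
of a second matrix `W'`, the inner product `⟨Z, W'⟩` is an average of the products `zᵢ w'ⱼ` with the
doubly stochastic weights `⟨vᵢ, v'ⱼ⟩²`, so the scalar subgradient inequalities can be averaged. -/
lemma conj_diagonal_mem_matSubdiff {J : Set ℝ} {f : ℝ → ℝ} {V : Matrix (Fin n) (Fin n) ℝ}
    (hV : Vᵀ * V = 1) {w z : Fin n → ℝ} (hz : ∀ i, z i ∈ subdiff J f (w i)) :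
    V * diagonal z * Vᵀ ∈ matSubdiff J f (V * diagonal w * Vᵀ) := by
  have hZh := isHermitian_conj_diagonal V z
  refine ⟨hZh, (conj_diagonal_mem_spectralDomain_iff hV).2 fun i => (hz i).1, ?_⟩
  rintro W' ⟨hW', hJ⟩
  obtain ⟨V', hV', hWe⟩ := exists_diagonalization hW'
  generalize hW'.eigenvalues = w' at hJ hWe
  subst hWe
  set P := Vᵀ * V' with hP
  have hrow : ∀ i, ∑ j, P i j ^ 2 = 1 := by
    intro i
    have h : P * Pᵀ = 1 := by
      rw [hP, transpose_mul, transpose_transpose]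
      calc Vᵀ * V' * (V'ᵀ * V) = Vᵀ * (V' * V'ᵀ) * V := by simp only [Matrix.mul_assoc]
        _ = 1 := by rw [mul_eq_one_comm.1 hV', Matrix.mul_one, hV]
    simpa [mul_apply, sq] using congrFun (congrFun h i) i
  have hcol : ∀ j, ∑ i, P i j ^ 2 = 1 := by
    intro j
    have h : Pᵀ * P = 1 := by
      rw [hP, transpose_mul, transpose_transpose]
      calc V'ᵀ * V * (Vᵀ * V') = V'ᵀ * (V * Vᵀ) * V' := by simp only [Matrix.mul_assoc]
        _ = 1 := by rw [mul_eq_one_comm.1 hV, Matrix.mul_one, hV']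
    simpa [mul_apply, sq] using congrFun (congrFun h j) j
  have hfrob : frob (V * diagonal z * Vᵀ) (V' * diagonal w' * V'ᵀ)
      = ∑ i, ∑ j, P i j ^ 2 * (z i * w' j) := by
    have h1 : V'ᵀ * (V * diagonal z * Vᵀ) * V' = Pᵀ * diagonal z * P := by
      rw [hP, transpose_mul, transpose_transpose]
      simp only [Matrix.mul_assoc]
    rw [frob_conj_diagonal hZh, h1, Finset.sum_comm]
    refine Finset.sum_congr rfl fun j _ => ?_
    rw [mul_apply, Finset.sum_mul]
    refine Finset.sum_congr rfl fun i _ => ?_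
    rw [mul_diagonal, transpose_apply]
    ring
  have hfrob' : frob (V * diagonal z * Vᵀ) (V * diagonal w * Vᵀ) = ∑ i, z i * w i := by
    rw [frob_conj_diagonal hZh, transpose_mul_conj_mul hV]
    simp
  have hsub : frob (V * diagonal z * Vᵀ) (V' * diagonal w' * V'ᵀ - V * diagonal w * Vᵀ)
      = frob (V * diagonal z * Vᵀ) (V' * diagonal w' * V'ᵀ)
        - frob (V * diagonal z * Vᵀ) (V * diagonal w * Vᵀ) := by
    simp [frob, Matrix.mul_sub]
  rw [hsub, hfrob, hfrob', spectralSum_conj_diagonal f hV, spectralSum_conj_diagonal f hV']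
  have hleft : ∀ c : Fin n → ℝ, ∑ i, c i = ∑ i, ∑ j, P i j ^ 2 * c i := fun c =>
    Finset.sum_congr rfl fun i _ => by rw [← Finset.sum_mul, hrow, one_mul]
  have hright : ∑ j, f (w' j) = ∑ i, ∑ j, P i j ^ 2 * f (w' j) := by
    rw [Finset.sum_comm]
    exact Finset.sum_congr rfl fun j _ => by rw [← Finset.sum_mul, hcol, one_mul]
  rw [hleft fun i => f (w i), hleft fun i => z i * w i, hright, ← Finset.sum_sub_distrib,
    ← Finset.sum_add_distrib]
  refine Finset.sum_le_sum fun i _ => ?_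
  rw [← Finset.sum_sub_distrib, ← Finset.sum_add_distrib]
  refine Finset.sum_le_sum fun j _ => ?_
  have h1 := mul_le_mul_of_nonneg_left ((hz i).2 (w' j) (hJ j)) (sq_nonneg (P i j))
  linarith

/-- A subgradient of a spectral function commutes with the base point. The function is constant on
the orbit `exp(tK) W exp(-tK)` of `W` under rotations, so the linear functional `⟨Z, ·⟩` is maximal
on it at `t = 0`; for the skew-symmetric `K = Z W - W Z` its derivative there is `tr(K Kᵀ)`. -/
lemma mul_comm_of_mem_matSubdiff {J : Set ℝ} {f : ℝ → ℝ} {W Z : Matrix (Fin n) (Fin n) ℝ}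
    (hZ : Z ∈ matSubdiff J f W) : Z * W = W * Z := by
  obtain ⟨hZh, ⟨hW, hJ⟩, hsub⟩ := hZ
  set K := Z * W - W * Z with hK
  have hKt : Kᵀ = -K := by
    have h1 : Zᵀ = Z := by rw [← conjTranspose_eq_transpose_of_trivial, hZh.eq]
    have h2 : Wᵀ = W := by rw [← conjTranspose_eq_transpose_of_trivial, hW.eq]
    rw [hK, transpose_sub, transpose_mul, transpose_mul, h1, h2, neg_sub]
  have hle : ∀ t : ℝ, (Z * (NormedSpace.exp (t • K) * W * NormedSpace.exp (t • -K))).trace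
      ≤ (Z * W).trace := by
    intro t
    set Q := NormedSpace.exp (t • K) with hQ
    have hQt : NormedSpace.exp (t • -K) = Qᵀ := by
      rw [hQ, ← Matrix.exp_transpose, transpose_smul, hKt]
    have hQQ : Qᵀ * Q = 1 := by
      rw [← hQt, hQ, ← Matrix.exp_add_of_commute]
      · simp
      · exact ((Commute.refl K).neg_left.smul_left t).smul_right t
    obtain ⟨V, hV, hWe⟩ := exists_diagonalization hW
    have hQV : (Q * V)ᵀ * (Q * V) = 1 := by
      rw [transpose_mul]
      calc Vᵀ * Qᵀ * (Q * V) = Vᵀ * (Qᵀ * Q) * V := by simp only [Matrix.mul_assoc]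
        _ = 1 := by rw [hQQ, Matrix.mul_one, hV]
    have hconj : Q * W * Qᵀ = (Q * V) * diagonal hW.eigenvalues * (Q * V)ᵀ := by
      conv_lhs => rw [hWe]
      simp only [Matrix.mul_assoc, transpose_mul]
    have h1 := hsub (Q * W * Qᵀ) (by
      rw [hconj, conj_diagonal_mem_spectralDomain_iff hQV]; exact hJ)
    have h2 : spectralSum f (Q * W * Qᵀ) = spectralSum f W := by
      rw [hconj, spectralSum_conj_diagonal f hQV, spectralSum, dif_pos hW]
    rw [h2, frob_eq_trace_mul hZh, Matrix.mul_sub, trace_sub] at h1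
    rw [hQt]
    linarith
  have hder : HasDerivAt
      (fun t : ℝ => (Z * (NormedSpace.exp (t • K) * W * NormedSpace.exp (t • -K))).trace)
      ((Z * (K * W + W * -K)).trace) 0 := by
    open scoped Matrix.Norms.Operator in
    have h1 := hasDerivAt_exp_smul_const (𝕂 := ℝ) K (0 : ℝ)
    have h2 := hasDerivAt_exp_smul_const (𝕂 := ℝ) (-K) (0 : ℝ)
    have h3 := (((h1.mul_const W).mul h2).const_mul Z)
    have h4 := (LinearMap.toContinuousLinearMap
      (Matrix.traceLinearMap (Fin n) ℝ ℝ)).hasFDerivAt.comp_hasDerivAt (0 : ℝ) h3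
    simp only [zero_smul, NormedSpace.exp_zero, Matrix.mul_one, Matrix.one_mul] at h4
    exact h4
  have hmax : IsLocalMax
      (fun t : ℝ => (Z * (NormedSpace.exp (t • K) * W * NormedSpace.exp (t • -K))).trace) 0 := by
    refine Filter.Eventually.of_forall fun t => ?_
    simpa using hle t
  have h0 := hmax.hasDerivAt_eq_zero hder
  have hKK : (K * Kᵀ).trace = 0 := by
    have h1 : (Z * (K * W + W * -K)).trace = (K * Kᵀ).trace := by
      have h2 : (Z * (K * W)).trace = (K * (W * Z)).trace := by
        rw [trace_mul_comm, Matrix.mul_assoc]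
      have h3 : (Z * (W * -K)).trace = -(K * (Z * W)).trace := by
        rw [← Matrix.mul_assoc, trace_mul_comm, Matrix.neg_mul, trace_neg]
      rw [Matrix.mul_add, trace_add, h2, h3, hKt, Matrix.mul_neg, trace_neg, ← sub_eq_add_neg,
        ← trace_sub, ← Matrix.mul_sub, hK, ← trace_neg, ← Matrix.mul_neg, neg_sub]
    rw [← h1, h0]
  rw [← conjTranspose_eq_transpose_of_trivial, trace_mul_conjTranspose_self_eq_zero_iff] at hKK
  exact sub_eq_zero.1 hKK

/-! ### Complementary positive semidefinite matrices -/

lemma posSemidef_conj_diagonal_iff {V : Matrix (Fin n) (Fin n) ℝ} (hV : Vᵀ * V = 1)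
    {a : Fin n → ℝ} : (V * diagonal a * Vᵀ).PosSemidef ↔ ∀ i, 0 ≤ a i := by
  constructor
  · intro h i
    have h1 := h.conjTranspose_mul_mul_same V
    rw [conjTranspose_eq_transpose_of_trivial, transpose_mul_conj_mul hV] at h1
    simpa using h1.diag_nonneg (i := i)
  · intro h
    have h1 := (PosSemidef.diagonal (show 0 ≤ a from h)).mul_mul_conjTranspose_same V
    rwa [conjTranspose_eq_transpose_of_trivial] at h1

lemma diag_conj_nonneg {A : Matrix (Fin n) (Fin n) ℝ} (hA : A.PosSemidef)
    (V : Matrix (Fin n) (Fin n) ℝ) (i : Fin n) : 0 ≤ (Vᵀ * A * V) i i := by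
  have h1 := hA.conjTranspose_mul_mul_same V
  rw [conjTranspose_eq_transpose_of_trivial] at h1
  exact h1.diag_nonneg

lemma smul_one_sub_conj_diagonal {V : Matrix (Fin n) (Fin n) ℝ} (hV : Vᵀ * V = 1) (c : ℝ)
    (a : Fin n → ℝ) : c • (1 : Matrix (Fin n) (Fin n) ℝ) - V * diagonal a * Vᵀ
      = V * diagonal (fun i => c - a i) * Vᵀ := by
  have h1 : diagonal (fun i => c - a i) = c • (1 : Matrix (Fin n) (Fin n) ℝ) - diagonal a := by
    rw [smul_one_eq_diagonal, diagonal_sub]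
  rw [h1, Matrix.mul_sub, Matrix.sub_mul, Matrix.mul_smul, Matrix.mul_one, Matrix.smul_mul,
    mul_eq_one_comm.1 hV]

lemma Complementary.mul_eq_zero {A B : Matrix (Fin n) (Fin n) ℝ} (h : Complementary A B) :
    A * B = 0 := by
  obtain ⟨hA, hB, hAB⟩ := h
  -- In an eigenbasis of `A` the trace is a sum of nonnegative terms `aᵢ ⟨B vᵢ, vᵢ⟩`, and
  -- `⟨B vᵢ, vᵢ⟩ = 0` forces `B vᵢ = 0`.
  obtain ⟨V, hV, hAe⟩ := exists_diagonalization hA.1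
  generalize hA.1.eigenvalues = a at hAe
  subst hAe
  have ha := (posSemidef_conj_diagonal_iff hV).1 hA
  have hC := hB.conjTranspose_mul_mul_same V
  rw [conjTranspose_eq_transpose_of_trivial] at hC
  set C := Vᵀ * B * V with hCdef
  have hBC : B = V * C * Vᵀ := eq_conj_transpose_mul hV B
  have htr : ∑ i, C i i * a i = 0 := by
    have h1 : frob (V * diagonal a * Vᵀ) B = frob B (V * diagonal a * Vᵀ) := by
      rw [frob_eq_trace_mul hA.1, frob_eq_trace_mul hB.1, trace_mul_comm]
    rw [← frob_conj_diagonal hB.1, ← h1, hAB]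
  have hdiag := (Finset.sum_eq_zero_iff_of_nonneg fun i _ =>
    mul_nonneg hC.diag_nonneg (ha i)).1 htr
  have hzero : diagonal a * C = 0 := by
    ext i j
    rw [diagonal_mul, Matrix.zero_apply]
    rcases _root_.mul_eq_zero.1 (hdiag i (Finset.mem_univ i)) with h | h
    · have h1 := (hC.dotProduct_mulVec_zero_iff (Pi.single i 1)).1 (by simpa using h)
      have h2 := congrFun h1 j
      have h3 := congrFun (congrFun hC.1 i) j
      simp only [conjTranspose_apply, star_trivial] at h3
      simp only [mulVec_single_one, col_apply, Pi.zero_apply] at h2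
      rw [← h3, h2, mul_zero]
    · rw [h, zero_mul]
  rw [hBC]
  calc V * diagonal a * Vᵀ * (V * C * Vᵀ) = V * (diagonal a * ((Vᵀ * V) * C)) * Vᵀ := by
        simp only [Matrix.mul_assoc]
    _ = 0 := by rw [hV, Matrix.one_mul, hzero, Matrix.mul_zero, Matrix.zero_mul]

lemma Complementary.mul_eq_zero' {A B : Matrix (Fin n) (Fin n) ℝ} (h : Complementary A B) :
    B * A = 0 := by
  have h1 := congrArg conjTranspose h.mul_eq_zero
  rwa [conjTranspose_mul, h.1.1.eq, h.2.1.1.eq, conjTranspose_zero] at h1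

/-! ### The matrix superdifferential and its inverse -/

lemma spectralDomain_Ici_zero :
    spectralDomain (Set.Ici 0) = {X : Matrix (Fin n) (Fin n) ℝ | X.PosSemidef} := by
  ext X
  exact ⟨fun ⟨h, hX⟩ => h.posSemidef_iff_eigenvalues_nonneg.2 hX,
    fun h => ⟨h.1, h.eigenvalues_nonneg⟩⟩

lemma spectralSum_neg (f : ℝ → ℝ) (X : Matrix (Fin n) (Fin n) ℝ) :
    spectralSum (fun x => -f x) X = -spectralSum f X := by
  unfold spectralSum
  split_ifs <;> simp

lemma frob_neg (U Y : Matrix (Fin n) (Fin n) ℝ) : frob (-U) Y = -frob U Y := by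
  simp [frob]

/-- `∂ρ(X)` is, up to sign and the bound `U ⪯ κ I`, the subdifferential of the spectral function of
the convex function `-ρ` with domain `[0, ∞)`. -/
lemma mem_matSuperdiff_iff {ρ : ℝ → ℝ} {κ : ℝ} {X U : Matrix (Fin n) (Fin n) ℝ}
    (hX : X.PosSemidef) :
    U ∈ matSuperdiff ρ κ X ↔ -U ∈ matSubdiff (Set.Ici 0) (fun x => -ρ x) X ∧
      (κ • (1 : Matrix (Fin n) (Fin n) ℝ) - U).PosSemidef := by
  simp only [matSuperdiff, matSubdiff, spectralDomain_Ici_zero, spectralSum_neg, frob_neg,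
    Set.mem_ofPred_eq]
  constructor
  · rintro ⟨h1, h2, h3⟩
    exact ⟨⟨h1.neg, hX, fun Y hY => by linarith [h2 Y hY]⟩, h3⟩
  · rintro ⟨⟨h1, -, h2⟩, h3⟩
    exact ⟨by simpa using h1.neg, fun Y hY => by linarith [h2 Y hY], h3⟩

variable {ρ : ℝ → ℝ} {κ : ℝ}

/-- Elements of `∂ρ(X)` share an eigenbasis with `X`, in which they are scalar supergradients. -/
lemma exists_common_diagonalization_of_mem_matSuperdiff {X U : Matrix (Fin n) (Fin n) ℝ}
    (hX : X.PosSemidef) (hU : U ∈ matSuperdiff ρ κ X) :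
    ∃ (V : Matrix (Fin n) (Fin n) ℝ) (x u : Fin n → ℝ), Vᵀ * V = 1 ∧ X = V * diagonal x * Vᵀ ∧
      U = V * diagonal u * Vᵀ ∧ ∀ i, 0 ≤ x i ∧ u i ∈ superdiff ρ κ (x i) := by
  obtain ⟨hsub, hκ⟩ := (mem_matSuperdiff_iff hX).1 hU
  have hcomm : X * U = U * X := by
    have := mul_comm_of_mem_matSubdiff hsub
    rw [Matrix.neg_mul, Matrix.mul_neg, neg_inj] at this
    exact this.symm
  obtain ⟨V, x, u, hV, rfl, rfl⟩ := exists_common_diagonalization hX.1 hU.1 hcomm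
  have hx := (posSemidef_conj_diagonal_iff hV).1 hX
  rw [smul_one_sub_conj_diagonal hV, posSemidef_conj_diagonal_iff hV] at hκ
  refine ⟨V, x, u, hV, rfl, rfl, fun i => ⟨hx i, ?_, sub_nonneg.1 (hκ i)⟩⟩
  have h1 := diag_mem_subdiff_of_mem_matSubdiff hV hsub i
  rw [Matrix.mul_neg, Matrix.neg_mul, transpose_mul_conj_mul hV] at h1
  simpa using (mem_subdiff_neg_iff (hx i)).1 (by simpa using h1)

lemma conj_diagonal_mem_matSuperdiff {V : Matrix (Fin n) (Fin n) ℝ} (hV : Vᵀ * V = 1)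
    {x u : Fin n → ℝ} (h : ∀ i, 0 ≤ x i ∧ u i ∈ superdiff ρ κ (x i)) :
    V * diagonal u * Vᵀ ∈ matSuperdiff ρ κ (V * diagonal x * Vᵀ) := by
  have hX := (posSemidef_conj_diagonal_iff hV).2 fun i => (h i).1
  refine (mem_matSuperdiff_iff hX).2 ⟨?_, ?_⟩
  · have h1 : -(V * diagonal u * Vᵀ) = V * diagonal (fun i => -u i) * Vᵀ := by
      rw [← diagonal_neg, Matrix.mul_neg, Matrix.neg_mul]
    rw [h1]
    exact conj_diagonal_mem_matSubdiff hV fun i => (mem_subdiff_neg_iff (h i).1).2 (h i).2.1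
  · rw [smul_one_sub_conj_diagonal hV, posSemidef_conj_diagonal_iff hV]
    exact fun i => sub_nonneg.2 (h i).2.2

variable {J : Set ℝ} {g : ℝ → ℝ}

/-- Elements of `∂ρ(X)` are positive semidefinite, and the scalar conjugacy relation between `ρ` and
`g` passes to the spectral functions. -/
lemma IsDualPenalty.posSemidef_and_neg_mem_matSubdiff (hg : IsDualPenalty ρ κ J g)
    (hρ : IsRegularizer ρ κ) {X U : Matrix (Fin n) (Fin n) ℝ} (hX : X.PosSemidef)
    (hU : U ∈ matSuperdiff ρ κ X) : U.PosSemidef ∧ -X ∈ matSubdiff J g U := by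
  obtain ⟨V, x, u, hV, rfl, rfl, h⟩ := exists_common_diagonalization_of_mem_matSuperdiff hX hU
  have hu := fun i => hρ.supergradient_nonneg (h i).1 (h i).2.1
  refine ⟨(posSemidef_conj_diagonal_iff hV).2 hu, ?_⟩
  have h1 : -(V * diagonal x * Vᵀ) = V * diagonal (fun i => -x i) * Vᵀ := by
    rw [← diagonal_neg, Matrix.mul_neg, Matrix.neg_mul]
  rw [h1]
  refine conj_diagonal_mem_matSubdiff hV fun i => ?_
  rw [hg.subdiff_eq (u i) ⟨hu i, (h i).2.2⟩]
  exact ⟨x i, (h i).1, (h i).2, rfl⟩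

/-- The stationarity condition in `W` of the biconvex program forces `W ∈ ∂ρ(X)`. The multipliers
`S`, `Y` of `0 ⪯ W ⪯ κ I` and `Z ∈ ∂G(W)` all commute with `W`, hence so does `X = S - Z - Y`. In a
common eigenbasis of `X` and `W` only the diagonals of `S`, `Y`, `Z` matter, although these matrices
need not be diagonal. -/
lemma IsDualPenalty.mem_matSuperdiff (hg : IsDualPenalty ρ κ J g) (hρ : IsRegularizer ρ κ)
    {X W Y Z : Matrix (Fin n) (Fin n) ℝ} (hX : X.PosSemidef) (hZ : Z ∈ matSubdiff J g W)
    (hW : Complementary W (X + Z + Y))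
    (hY : Complementary Y (κ • (1 : Matrix (Fin n) (Fin n) ℝ) - W)) :
    W ∈ matSuperdiff ρ κ X := by
  obtain ⟨S, hS⟩ : ∃ S, S = X + Z + Y := ⟨_, rfl⟩
  rw [← hS] at hW
  have hXe : X = S - Z - Y := by rw [hS]; abel
  have hSW := hW.mul_eq_zero'
  have hWS := hW.mul_eq_zero
  have hYW := hY.mul_eq_zero
  have hWY := hY.mul_eq_zero'
  have hcomm : X * W = W * X := by
    have h1 : Y * W = κ • Y := by
      rw [Matrix.mul_sub, Matrix.mul_smul, Matrix.mul_one, sub_eq_zero] at hYW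
      exact hYW.symm
    have h2 : W * Y = κ • Y := by
      rw [Matrix.sub_mul, Matrix.smul_mul, Matrix.one_mul, sub_eq_zero] at hWY
      exact hWY.symm
    rw [hXe]
    simp only [Matrix.sub_mul, Matrix.mul_sub, hSW, hWS, h1, h2, mul_comm_of_mem_matSubdiff hZ]
  have hWpos := hW.1
  have hκ := hY.2.1
  have hSpos := hW.2.1
  obtain ⟨V, x, w, hV, hXV, rfl⟩ := exists_common_diagonalization hX.1 hWpos.1 hcomm
  have hx := (posSemidef_conj_diagonal_iff hV).1 (hXV ▸ hX)
  have hw := (posSemidef_conj_diagonal_iff hV).1 hWpos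
  rw [smul_one_sub_conj_diagonal hV] at hκ hYW
  rw [posSemidef_conj_diagonal_iff hV] at hκ
  -- The diagonal of `Vᵀ A V` vanishes against `b` when `A V diag(b) Vᵀ = 0`.
  have hprod : ∀ (A : Matrix (Fin n) (Fin n) ℝ) (b : Fin n → ℝ),
      A * (V * diagonal b * Vᵀ) = 0 → ∀ i, (Vᵀ * A * V) i i * b i = 0 := by
    intro A b hAb i
    have h1 : Vᵀ * A * V * diagonal b = 0 := by
      calc Vᵀ * A * V * diagonal b = Vᵀ * (A * (V * diagonal b * Vᵀ)) * V := by
            rw [← Matrix.mul_one (Vᵀ * A * V * diagonal b), ← hV]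
            simp only [Matrix.mul_assoc]
        _ = 0 := by rw [hAb, Matrix.mul_zero, Matrix.zero_mul]
    simpa using congrFun (congrFun h1 i) i
  rw [hXV]
  refine conj_diagonal_mem_matSuperdiff hV fun i => ⟨hx i, ?_⟩
  have hz := diag_mem_subdiff_of_mem_matSubdiff hV hZ i
  rw [hg.subdiff_eq (w i) ⟨hw i, sub_nonneg.1 (hκ i)⟩] at hz
  obtain ⟨x₀, hx₀, hwx₀, hzx₀⟩ := hz
  have hxi : x i = x₀ + (Vᵀ * S * V) i i - (Vᵀ * Y * V) i i := by
    have h1 : Vᵀ * X * V = diagonal x := by rw [hXV, transpose_mul_conj_mul hV]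
    have h2 := congrFun (congrFun h1 i) i
    rw [hXe, Matrix.mul_sub, Matrix.mul_sub, Matrix.sub_mul, Matrix.sub_mul, Matrix.sub_apply,
      Matrix.sub_apply,
      hzx₀, diagonal_apply_eq] at h2
    linarith
  exact hρ.mem_superdiff_of_complementary hwx₀ hx₀ (hx i) (diag_conj_nonneg hSpos V i)
    (diag_conj_nonneg hY.1 V i) (hprod S w hSW i) (hprod Y _ hYW i) hxi

end BiconvexSDP

theorem proposition1 (ρ : ℝ → ℝ) (κ : ℝ) (hρ : BiconvexSDP.IsRegularizer ρ κ) :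
    (∃ (J : Set ℝ) (g : ℝ → ℝ), BiconvexSDP.IsDualPenalty ρ κ J g) ∧
    ∀ (J : Set ℝ) (g : ℝ → ℝ), BiconvexSDP.IsDualPenalty ρ κ J g →
      ∀ (n m : ℕ) (φ : Matrix (Fin n) (Fin n) ℝ → ℝ)
        (A : Fin m → Matrix (Fin n) (Fin n) ℝ) (b : Fin m → ℝ),
        (∀ j, (A j).IsHermitian) →
        (∀ X, BiconvexSDP.IsKKTRelaxation ρ κ φ A b X →
          ∃ W ∈ BiconvexSDP.matSuperdiff ρ κ X, BiconvexSDP.IsKKTBiconvex J g κ φ A b X W) ∧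
        (∀ X W, BiconvexSDP.IsKKTBiconvex J g κ φ A b X W →
          BiconvexSDP.IsKKTRelaxation ρ κ φ A b X ∧ W ∈ BiconvexSDP.matSuperdiff ρ κ X) := by
  refine ⟨⟨_, _, hρ.isDualPenalty_convexConj⟩, fun J g hg n m φ A b _ => ⟨?_, ?_⟩⟩
  · rintro X ⟨hX, hAX, U, hU, D, hD, μ, hcomp⟩
    obtain ⟨hUpos, hsub⟩ := hg.posSemidef_and_neg_mem_matSubdiff hρ hX hU
    -- The multiplier of `W ⪯ κ I` is `0` and the subgradient of `G` at `W = U` is `-X`.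
    refine ⟨U, hU, hX, hAX, hUpos, hU.2.2, -X, hsub, 0, D, hD, μ, ?_, hcomp, ?_⟩
    · exact ⟨hUpos, by simpa using Matrix.PosSemidef.zero, by simp [BiconvexSDP.frob]⟩
    · exact ⟨Matrix.PosSemidef.zero, hU.2.2, by simp [BiconvexSDP.frob]⟩
  · rintro X W ⟨hX, hAX, -, -, Z, hZ, Y, D, hD, μ, hW, hcomp, hY⟩
    have hWρ := hg.mem_matSuperdiff hρ hX hZ hW hY
    exact ⟨⟨hX, hAX, W, hWρ, D, hD, μ, hcomp⟩, hWρ⟩
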